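/- Let $n\ge 1$ and let $\mathscr M$ be an $n$-abelian category in which every object satisfies the ascending and the descending chain condition on subobjects. (This holds whenever $\mathscr M$ is an $n$-cluster-tilting subcategory of an abelian length category.) Definitions. An $n$-cokernel of $f^0\colon X^0\to X^1$ is a sequence $X^1\xrightarrow{f^1}\cdots\xrightarrow{f^n}X^{n+1}$ such that $0\to\mathscr M(X^{n+1},Y)\to\cdots\to\mathscr M(X^1,Y)\to\mathscr M(X^0,Y)$ is exact for all $Y\in\mathscr M$; $n$-kernels are defined dually, and $X^0\to X^1\to\cdots\to X^{n+1}$ is $n$-exact if $(f^1,\dots,f^n)$ is an $n$-cokernel of $f^0$ and $(f^0,\dots,f^{n-1})$ is an $n$-kernel of $f^n$. For a class of objects $\mathscr U$, a morphism $U^M\to M$ with $U^M\in\mathscr U$ is the torsion subobject of $M$ with respect to $\mathscr U$ if there is an $n$-exact sequence $0\to U^M\to M\to V^1\to\cdots\to V^n\to 0$ such that $0\to\mathscr M(U,V^1)\to\cdots\to\mathscr M(U,V^n)\to 0$ is exact for all $U\in\mathscr U$. An $n$-torsion class is a full, isomorphism-closed subcategory $\mathscr U$ with respect to which every $M\in\mathscr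 M$ has a torsion subobject. A chain of $n$-torsion classes is a family $\delta=\{\mathscr U_s : s\in[0,1]\}$ of $n$-torsion classes with $\mathscr U_0=\mathscr M$, $\mathscr U_1=\{0\}$ and $\mathscr U_s\subseteq\mathscr U_r$ for $r\le s$; by convention $\bigcap_{s<0}\mathscr U_s=\mathscr M$ and $\bigcup_{r>1}\mathscr U_r=\{0\}$. For $t\in[0,1]$ let $S_t=\bigcap_{s<t}\mathscr U_s\setminus\bigcup_{r>t}\mathscr U_r$, and let the slice $\mathcal Q_t$ be the class of all sequences $V^1\to\cdots\to V^n$ for which there are an object $N\in S_t$ and an $n$-cokernel $N\to V^1\to\cdots\to V^n$ of the torsion subobject $U\to N$ of $N$ with respect to $\bigcup_{r>t}\mathscr U_r$. Theorem. Let $\delta$ be a chain of $n$-torsion classes in $\mathscr M$. Then every object $M$ of $\mathscr M$ has an $n$-Harder–Narasimhan filtration, that is, a filtration by subobjects $$0=M_0\subsetneq M_1\subsetneq\cdots\subsetneq M_r=M\qquad(r\ge 0)$$ together with phases $s_1>s_2>\cdots>s_r$ in $[0,1]$ such that for every $1\le k\le r$ the inclusion $M_{k-1}\to M_k$ has an $n$-cokernel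 $M_k\to V^1\to\cdots\to V^n$ with $(V^1\to\cdots\to V^n)\in\mathcal Q_{s_k}$. The filtration is unique up to isomorphism: any two such filtrations of $M$ have the same length, the same phases and the same terms as subobjects of $M$. Moreover, for every $1\le i\le r$, $M_i\in S_{s_i}$ and $M_{i-1}\to M_i$ is the torsion subobject of $M_i$ with respect to $\bigcup_{r>s_i}\mathscr U_r$. -/

import Mathlib

open CategoryTheory CategoryTheory.Limits

universe v u

namespace HigherHN

variable {C : Type u} [Category.{v} C]

/-! ### Sequences `X⁰ ⟶ X¹ ⟶ ⋯ ⟶ Xⁿ⁺¹` -/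

/-- The sequence `X⁰ ⟶ X¹ ⟶ ⋯` starts with the morphism `f`, up to an isomorphism of arrows. -/
def StartsWith {n : ℕ} (S : ComposableArrows C (n + 1)) {X Y : C} (f : X ⟶ Y) : Prop :=
  ∃ (e₀ : S.obj' 0 ≅ X) (e₁ : S.obj' 1 ≅ Y), S.map' 0 1 ≫ e₁.hom = e₀.hom ≫ f

/-- The sequence `X⁰ ⟶ ⋯ ⟶ Xⁿ ⟶ Xⁿ⁺¹` ends with the morphism `f`, up to an isomorphism of
arrows. -/
def EndsWith {n : ℕ} (S : ComposableArrows C (n + 1)) {X Y : C} (f : X ⟶ Y) : Prop :=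
  ∃ (e₀ : S.obj' n ≅ X) (e₁ : S.obj' (n + 1) ≅ Y), S.map' n (n + 1) ≫ e₁.hom = e₀.hom ≫ f

/-- For `n ≥ 1`, the truncation `X² ⟶ ⋯ ⟶ Xⁿ⁺¹` of a sequence `X⁰ ⟶ X¹ ⟶ ⋯ ⟶ Xⁿ⁺¹`; it has `n`
objects, i.e. `n - 1` arrows. (The value for `n = 0` is irrelevant.) -/
def tail : ∀ {n : ℕ}, ComposableArrows C (n + 1) → ComposableArrows C (n - 1)
  | 0, S => ComposableArrows.mk₀ (S.obj' 0)
  | _ + 1, S => S.δ₀.δ₀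

section Preadditive

variable [Preadditive C]

/-- In the sequence `f⁰, …, fⁿ`, the tuple `(f¹, …, fⁿ)` is an `n`-cokernel of `f⁰`: for all `Y`,
`0 ⟶ Hom(Xⁿ⁺¹, Y) ⟶ Hom(Xⁿ, Y) ⟶ ⋯ ⟶ Hom(X¹, Y) ⟶ Hom(X⁰, Y)` is exact. -/
structure IsNCokernel {n : ℕ} (S : ComposableArrows C (n + 1)) : Prop where
  injective (Y : C) : Function.Injective
    (fun h : S.obj' (n + 1) ⟶ Y => S.map' n (n + 1) ≫ h)
  exact (Y : C) (i : ℕ) (hi : i < n) : Function.Exact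
    (fun h : S.obj' (i + 2) ⟶ Y => S.map' (i + 1) (i + 2) ≫ h)
    (fun h : S.obj' (i + 1) ⟶ Y => S.map' i (i + 1) ≫ h)

/-- In the sequence `f⁰, …, fⁿ`, the tuple `(f⁰, …, fⁿ⁻¹)` is an `n`-kernel of `fⁿ`: for all `Y`,
`0 ⟶ Hom(Y, X⁰) ⟶ Hom(Y, X¹) ⟶ ⋯ ⟶ Hom(Y, Xⁿ) ⟶ Hom(Y, Xⁿ⁺¹)` is exact. -/
structure IsNKernel {n : ℕ} (S : ComposableArrows C (n + 1)) : Prop where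
  injective (Y : C) : Function.Injective
    (fun h : Y ⟶ S.obj' 0 => h ≫ S.map' 0 1)
  exact (Y : C) (i : ℕ) (hi : i < n) : Function.Exact
    (fun h : Y ⟶ S.obj' i => h ≫ S.map' i (i + 1))
    (fun h : Y ⟶ S.obj' (i + 1) => h ≫ S.map' (i + 1) (i + 2))

/-- `n`-exact sequences `X⁰ ⟶ X¹ ⟶ ⋯ ⟶ Xⁿ⁺¹`. -/
structure IsNExact {n : ℕ} (S : ComposableArrows C (n + 1)) : Prop where
  isNCokernel : IsNCokernel S
  isNKernel : IsNKernel S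

/-- For a sequence `V⁰ ⟶ ⋯ ⟶ Vᵐ` and a class of objects `P`, the sequences
`0 ⟶ Hom(U, V⁰) ⟶ ⋯ ⟶ Hom(U, Vᵐ) ⟶ 0` are exact for all objects `U` in `P`. -/
structure HomExact (P : ObjectProperty C) {m : ℕ} (V : ComposableArrows C m) : Prop where
  zero (U : C) (hU : P U) (hm : m = 0) (u : U ⟶ V.obj' 0) : u = 0
  injective (U : C) (hU : P U) (hm : 1 ≤ m) :
    Function.Injective (fun u : U ⟶ V.obj' 0 => u ≫ V.map' 0 1)
  exact (U : C) (hU : P U) (i : ℕ) (hi : i + 2 ≤ m) : Function.Exact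
    (fun u : U ⟶ V.obj' i => u ≫ V.map' i (i + 1))
    (fun u : U ⟶ V.obj' (i + 1) => u ≫ V.map' (i + 1) (i + 2))
  surjective (U : C) (hU : P U) (hm : 1 ≤ m) :
    Function.Surjective (fun u : U ⟶ V.obj' (m - 1) => u ≫ V.map' (m - 1) m)

/-! ### `n`-torsion classes -/

/-- The morphism `f : X ⟶ M` is the `n`-torsion subobject of `M` with respect to the class `P`:
`X` is in `P` and there is an `n`-exact sequence `0 ⟶ X ⟶ M ⟶ V¹ ⟶ ⋯ ⟶ Vⁿ ⟶ 0` starting with `f`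
such that `0 ⟶ Hom(U, V¹) ⟶ ⋯ ⟶ Hom(U, Vⁿ) ⟶ 0` is exact for all `U` in `P`. -/
def IsTorsionSubobject (n : ℕ) (P : ObjectProperty C) {X M : C} (f : X ⟶ M) : Prop :=
  P X ∧ ∃ S : ComposableArrows C (n + 1),
    StartsWith S f ∧ IsNExact S ∧ HomExact P (tail S)

/-- `n`-torsion classes: (isomorphism-closed) full subcategories `P` such that every object has an
`n`-torsion subobject with respect to `P`. -/
structure IsNTorsionClass (n : ℕ) (P : ObjectProperty C) : Prop where
  closedUnderIso : P.IsClosedUnderIsomorphisms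
  exists_torsionSubobject (M : C) : ∃ (X : C) (f : X ⟶ M), IsTorsionSubobject n P f

variable (C) in
/-- Chains of `n`-torsion classes, indexed by the real interval `[0,1]`. -/
structure NTorsionChain (n : ℕ) where
  /-- the class indexed by `s` -/
  U : unitInterval → ObjectProperty C
  isNTorsionClass (s : unitInterval) : IsNTorsionClass n (U s)
  zero (X : C) : U 0 X
  one (X : C) : U 1 X ↔ IsZero X
  antitone (r s : unitInterval) (h : r ≤ s) (X : C) : U s X → U r X

namespace NTorsionChain

variable {n : ℕ} (δ : NTorsionChain C n)

/-- The union of the classes `U_r` with `r > t`. By convention it is the class of zero objects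
for `t = 1` (zero objects belong to the union for `t < 1` as well, since they belong to `U_1`). -/
def above (t : unitInterval) : ObjectProperty C :=
  fun X => IsZero X ∨ ∃ r, t < r ∧ δ.U r X

/-- The intersection of the classes `U_s` with `s < t` (it is the class of all objects for
`t = 0`). -/
def below (t : unitInterval) : ObjectProperty C :=
  fun X => ∀ s, s < t → δ.U s X

/-- `S_t`: the objects of `⋂_{s < t} U_s` that are not in `⋃_{r > t} U_r`. -/
def S (t : unitInterval) : ObjectProperty C :=
  fun X => δ.below t X ∧ ¬ δ.above t X

/-- The slice `Q_t`: all `V¹ ⟶ ⋯ ⟶ Vⁿ` such that, for some object `M` of `S_t` with torsion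
subobject `α : X ⟶ M` with respect to `⋃_{r > t} U_r`, there is an `n`-cokernel
`M ⟶ V¹ ⟶ ⋯ ⟶ Vⁿ` of `α`. -/
def slice (t : unitInterval) : ObjectProperty (ComposableArrows C (n - 1)) :=
  fun V => ∃ (X M : C) (α : X ⟶ M), δ.S t M ∧ IsTorsionSubobject n (δ.above t) α ∧
    ∃ T : ComposableArrows C (n + 1), StartsWith T α ∧ IsNCokernel T ∧ Nonempty (tail T ≅ V)

end NTorsionChain

/-! ### `n`-Harder–Narasimhan filtrations -/

variable [HasZeroObject C]

/-- An `n`-Harder–Narasimhan filtration of `M` with respect to `δ`: subobjects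
`0 = M_0 ⊊ M_1 ⊊ ⋯ ⊊ M_r = M` and phases `s_1 > ⋯ > s_r` in `[0,1]` (here `s_{k+1}` is `phase k`)
such that the `n`-cokernel of `M_{k-1} ⟶ M_k` lies in `Q_{s_k}` for all `1 ≤ k ≤ r`. An `n`-cokernel
is determined up to homotopy equivalence, under which membership in `Q_{s_k}` is invariant.
As subobjects of `M` are isomorphism classes of monomorphisms into `M`, two such filtrations are
equal if and only if they are isomorphic and have the same phases. -/
structure HNFiltration {n : ℕ} (δ : NTorsionChain C n) (M : C) where
  /-- the length `r` of the filtration -/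
  length : ℕ
  /-- the subobject `M_i` of `M` -/
  sub : Fin (length + 1) → Subobject M
  /-- the phases -/
  phase : Fin length → unitInterval
  sub_zero : sub 0 = ⊥
  sub_last : sub (Fin.last length) = ⊤
  strictMono : StrictMono sub
  strictAnti : StrictAnti phase
  slice (k : Fin length) : ∃ T : ComposableArrows C (n + 1),
    StartsWith T (Subobject.ofLE (sub k.castSucc) (sub k.succ)
      (strictMono.monotone (Fin.castSucc_le_succ k))) ∧
    IsNCokernel T ∧ δ.slice (phase k) (tail T)

/-! ### `n`-abelian categories -/

variable [HasFiniteBiproducts C]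

variable (C) in
/-- An additive category is `n`-abelian if idempotents split, every morphism has an `n`-kernel and
an `n`-cokernel, every monomorphism together with any `n`-cokernel of it is an `n`-exact sequence,
and dually for epimorphisms. -/
structure IsNAbelian (n : ℕ) : Prop where
  isIdempotentComplete : IsIdempotentComplete C
  exists_isNKernel {X Y : C} (f : X ⟶ Y) :
    ∃ S : ComposableArrows C (n + 1), EndsWith S f ∧ IsNKernel S
  exists_isNCokernel {X Y : C} (f : X ⟶ Y) :
    ∃ S : ComposableArrows C (n + 1), StartsWith S f ∧ IsNCokernel S
  isNExact_of_mono (S : ComposableArrows C (n + 1)) :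
    Mono (S.map' 0 1) → IsNCokernel S → IsNExact S
  isNExact_of_epi (S : ComposableArrows C (n + 1)) :
    Epi (S.map' n (n + 1)) → IsNKernel S → IsNExact S

end Preadditive

end HigherHN

/-!
Existence. A nonzero object `M` lies in `S_t` for exactly one `t`, its phase, which is the supremum
of all `r` with `M` in `U_r`. By the ascending chain condition, `M` has a torsion subobject
`M' ⟶ M` with respect to the union of the `U_r` with `r > t`
(`NTorsionChain.exists_torsionSubobject_above`). Here `M'` is a proper subobject because `M` is not
in this union, `M'` is zero or has a phase larger than `t`, and the `n`-cokernel of `M' ⟶ M` is in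
the slice `Q_t` by definition.
Iterating this step yields a filtration from the top downwards, which is finite by the descending
chain condition.

Uniqueness. Each step is determined by `M`, so it is enough that every filtration arises in this way
(`HNFiltration.isStepChain`). Let `V` be the `n`-cokernel of `M_{k-1} ⟶ M_k`. By definition of the
slice, `V` is also the `n`-cokernel of the torsion subobject of some `N` in `S_{s_k}`. By induction
on `k`, `M_{k-1}` is zero or has phase `s_{k-1} > s_k`, so it is in the union of the `U_r` with
`r > s_k`, and `M_{k-1} ⟶ M_k` is the torsion subobject with respect to this union. It remains to
see that `M_k` is in `U_s` for all `s < s_k`, which is a closure property of the torsion class `U_s`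
under `n`-extensions (`IsNTorsionClass.prop_of_tail_iso`): if `Z` is the `n`-cokernel of the torsion
subobject of `M_k` with respect to `U_s`, then `M_k ⟶ Z¹` factors through `V¹ ⟶ Z¹`; the latter
kills `N`, hence factors through `V²` (or is zero, if `n = 1`), and therefore `M_k ⟶ Z¹` is zero.

The definition of a torsion subobject refers to one particular `n`-exact sequence. That any other
one with the same first morphism serves as well (`IsTorsionSubobject.homExact_tail`) is due to the
uniqueness of `n`-cokernels up to homotopy equivalence.
-/

namespace HigherHN

/-! ### Comparison of `n`-cokernels and exactness of the tail -/

section Sequences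

variable {C : Type u} [Category.{v} C]

lemma inv_comp_eq_comp_inv {A B X Y : C} {d : A ⟶ B} {f : X ⟶ Y} {e₀ : A ≅ X} {e₁ : B ≅ Y}
    (w : d ≫ e₁.hom = e₀.hom ≫ f) : e₀.inv ≫ d = f ≫ e₁.inv := by
  rw [Iso.inv_comp_eq, ← Category.assoc, Iso.eq_comp_inv, w]

lemma StartsWith.precomp_iso {n : ℕ} {S : ComposableArrows C (n + 1)} {X X' Y : C} {f : X ⟶ Y}
    (h : StartsWith S f) (e : X' ≅ X) : StartsWith S (e.hom ≫ f) := by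
  obtain ⟨e₀, e₁, w⟩ := h
  exact ⟨e₀ ≪≫ e.symm, e₁, by
    rw [w, Iso.trans_hom, Iso.symm_hom, Category.assoc, Iso.inv_hom_id_assoc]⟩

lemma StartsWith.mono_iff {n : ℕ} {S : ComposableArrows C (n + 1)} {X Y : C} {f : X ⟶ Y}
    (h : StartsWith S f) : Mono (S.map' 0 1) ↔ Mono f := by
  obtain ⟨e₀, e₁, w⟩ := h
  constructor
  · intro _
    rw [← (Iso.inv_comp_eq _).2 w]
    infer_instance
  · intro _
    rw [(Iso.inv_comp_eq _).1 (inv_comp_eq_comp_inv w)]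
    infer_instance

variable [Preadditive C]

namespace IsNCokernel

variable {n : ℕ} {S : ComposableArrows C (n + 1)}

lemma comp_eq_zero (hS : IsNCokernel S) (i : ℕ) (hi : i < n) :
    S.map' i (i + 1) ≫ S.map' (i + 1) (i + 2) = 0 :=
  (hS.exact _ i hi (S.map' (i + 1) (i + 2))).2 ⟨𝟙 _, Category.comp_id _⟩

lemma exists_desc (hS : IsNCokernel S) (i : ℕ) (hi : i < n) {Y : C} (g : S.obj' (i + 1) ⟶ Y)
    (hg : S.map' i (i + 1) ≫ g = 0) :
    ∃ h : S.obj' (i + 2) ⟶ Y, S.map' (i + 1) (i + 2) ≫ h = g :=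
  (hS.exact Y i hi g).1 hg

lemma eq_zero_of_last (hS : IsNCokernel S) {Y : C} (g : S.obj' (n + 1) ⟶ Y)
    (hg : S.map' n (n + 1) ≫ g = 0) : g = 0 :=
  hS.injective Y (hg.trans comp_zero.symm)

/-- The comparison of two `n`-cokernels of the same morphism at a single index. There are
`φ` and `ψ` between the terms of index `i + 1` that extend to commutative squares with the terms of
index `i`, and `ψ` after `φ` is the identity up to a homotopy `h` and up to a morphism killed by the
differential. Keeping only this local information is enough to pass from `i` to `i + 1`. -/
lemma exists_comparison {S' : ComposableArrows C (n + 1)} (hS : IsNCokernel S)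
    (hS' : IsNCokernel S') {X Y : C} {f : X ⟶ Y} (hf : StartsWith S f) (hf' : StartsWith S' f)
    (i : ℕ) (hi : i ≤ n) :
    have hi₀ : i ≤ n + 1 := Nat.le_succ_of_le hi
    have hi₁ : i + 1 ≤ n + 1 := Nat.succ_le_succ hi
    ∃ (φ : S.obj' (i + 1) hi₁ ⟶ S'.obj' (i + 1) hi₁)
      (ψ : S'.obj' (i + 1) hi₁ ⟶ S.obj' (i + 1) hi₁)
      (h : S.obj' (i + 1) hi₁ ⟶ S.obj' i hi₀)
      (a : S.obj' i hi₀ ⟶ S'.obj' i hi₀) (b : S'.obj' i hi₀ ⟶ S.obj' i hi₀),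
      S.map' i (i + 1) ≫ φ = a ≫ S'.map' i (i + 1) ∧
      S'.map' i (i + 1) ≫ ψ = b ≫ S.map' i (i + 1) ∧
      S.map' i (i + 1) ≫ (𝟙 (S.obj' (i + 1) hi₁) - φ ≫ ψ - h ≫ S.map' i (i + 1)) = 0 := by
  induction i with
  | zero =>
    obtain ⟨e₀, e₁, w⟩ := hf
    obtain ⟨e₀', e₁', w'⟩ := hf'
    refine ⟨e₁.hom ≫ e₁'.inv, e₁'.hom ≫ e₁.inv, 0, e₀.hom ≫ e₀'.inv, e₀'.hom ≫ e₀.inv,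
      ?_, ?_, ?_⟩
    · rw [reassoc_of% w, Category.assoc, inv_comp_eq_comp_inv w']
    · rw [reassoc_of% w', Category.assoc, inv_comp_eq_comp_inv w]
    · rw [Category.assoc, Iso.inv_hom_id_assoc, Iso.hom_inv_id, zero_comp, sub_self, sub_zero,
        comp_zero]
  | succ i ih =>
    obtain ⟨φ, ψ, h, a, b, ha, hb, hh⟩ := ih (by omega)
    have d := hS.comp_eq_zero i (by omega)
    have d' := hS'.comp_eq_zero i (by omega)
    obtain ⟨φ', hφ'⟩ := hS.exists_desc i (by omega) (φ ≫ S'.map' (i + 1) (i + 2))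
      (by rw [reassoc_of% ha, d', comp_zero])
    obtain ⟨ψ', hψ'⟩ := hS'.exists_desc i (by omega) (ψ ≫ S.map' (i + 1) (i + 2))
      (by rw [reassoc_of% hb, d, comp_zero])
    obtain ⟨h', hh'⟩ := hS.exists_desc i (by omega) _ hh
    refine ⟨φ', ψ', h', φ, ψ, hφ', hψ', ?_⟩
    rw [Preadditive.comp_sub, Preadditive.comp_sub, reassoc_of% hφ', hψ', reassoc_of% hh',
      Preadditive.sub_comp, Preadditive.sub_comp, Category.assoc, Category.assoc, d]
    simp

/-- Whether `Hom(U, Xⁿ) ⟶ Hom(U, Xⁿ⁺¹)` is surjective depends only on the first morphism of the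
sequence, because an `n`-cokernel is unique up to homotopy equivalence. -/
lemma surjective_last_of_startsWith {S' : ComposableArrows C (n + 1)} (hS : IsNCokernel S)
    (hS' : IsNCokernel S') {X Y : C} {f : X ⟶ Y} (hf : StartsWith S f) (hf' : StartsWith S' f)
    {U : C} (hU : Function.Surjective (fun u : U ⟶ S'.obj' n => u ≫ S'.map' n (n + 1))) :
    Function.Surjective (fun u : U ⟶ S.obj' n => u ≫ S.map' n (n + 1)) := by
  intro u
  obtain ⟨φ, ψ, h, a, b, -, hb, hh⟩ := hS.exists_comparison hS' hf hf' n le_rfl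
  obtain ⟨w, hw⟩ := hU (u ≫ φ)
  have key : 𝟙 _ = φ ≫ ψ + h ≫ S.map' n (n + 1) := by
    have := hS.eq_zero_of_last _ hh
    rwa [sub_sub, sub_eq_zero] at this
  refine ⟨w ≫ b + u ≫ h, ?_⟩
  dsimp only at hw ⊢
  rw [Preadditive.add_comp, Category.assoc, Category.assoc, ← hb, reassoc_of% hw,
    ← Preadditive.comp_add, ← key, Category.comp_id]

end IsNCokernel

lemma IsNKernel.mono {n : ℕ} {S : ComposableArrows C (n + 1)} (hS : IsNKernel S) :
    Mono (S.map' 0 1) :=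
  ⟨fun _ _ h => hS.injective _ h⟩

lemma IsNKernel.exists_lift {n : ℕ} {S : ComposableArrows C (n + 1)} (hS : IsNKernel S) (i : ℕ)
    (hi : i < n) {Y : C} (g : Y ⟶ S.obj' (i + 1)) (hg : g ≫ S.map' (i + 1) (i + 2) = 0) :
    ∃ h : Y ⟶ S.obj' i, h ≫ S.map' i (i + 1) = g :=
  (hS.exact Y i hi g).1 hg

/-- For an `n`-exact sequence, the exactness of `0 ⟶ Hom(U, X²) ⟶ ⋯ ⟶ Hom(U, Xⁿ⁺¹) ⟶ 0` amounts to
conditions at its two ends only, the rest being part of the `n`-kernel property. This form also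
treats the case `n = 1`, where the sequence is `0 ⟶ Hom(U, X²) ⟶ 0`, uniformly. -/
lemma IsNExact.homExact_tail_iff {m : ℕ} {S : ComposableArrows C (m + 1 + 1)} (hS : IsNExact S)
    (P : ObjectProperty C) :
    HomExact P (tail S) ↔ ∀ U, P U →
      Function.Surjective (fun u : U ⟶ S.obj' 0 => u ≫ S.map' 0 1) ∧
      Function.Surjective (fun u : U ⟶ S.obj' (m + 1) => u ≫ S.map' (m + 1) (m + 2)) := by
  have d := hS.isNCokernel.comp_eq_zero
  constructor
  · intro h U hU
    refine ⟨fun u => hS.isNKernel.exists_lift 0 (by omega) u ?_, ?_⟩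
    · rcases Nat.eq_zero_or_pos m with hm | hm
      · exact h.zero U hU hm _
      · refine h.injective U hU hm (Eq.trans ?_ zero_comp.symm)
        exact (Category.assoc _ _ _).trans ((congrArg (u ≫ ·) (d 1 (by omega))).trans comp_zero)
    · rcases m with _ | m
      · intro u
        exact ⟨0, zero_comp.trans (h.zero U hU rfl u).symm⟩
      · exact h.surjective U hU (by omega)
  · intro h
    have key : ∀ U, P U → ∀ u : U ⟶ S.obj' 1, u ≫ S.map' 1 2 = 0 := by
      intro U hU u
      obtain ⟨w, rfl⟩ := (h U hU).1 u
      exact (Category.assoc _ _ _).trans ((congrArg (w ≫ ·) (d 0 (by omega))).trans comp_zero)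
    refine ⟨?_, ?_, ?_, ?_⟩
    · rintro U hU rfl u
      obtain ⟨w, rfl⟩ := (h U hU).2 u
      exact key U hU w
    · intro U hU hm
      have : ∀ u : U ⟶ S.obj' 2, u ≫ S.map' 2 3 = 0 → u = 0 := by
        intro u hu
        obtain ⟨w, rfl⟩ := hS.isNKernel.exists_lift 1 (by omega) u hu
        exact key U hU w
      intro u u' huu
      exact sub_eq_zero.1 (this (u - u')
        ((Preadditive.sub_comp _ _ _).trans (sub_eq_zero.2 huu)))
    · intro U hU i hi
      exact hS.isNKernel.exact U (i + 2) (by omega)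
    · rintro U hU hm
      obtain ⟨m, rfl⟩ : ∃ k, m = k + 1 := ⟨m - 1, by omega⟩
      exact (h U hU).2

lemma HomExact.of_iso {P : ObjectProperty C} {m : ℕ} {V W : ComposableArrows C m}
    (h : HomExact P V) (e : V ≅ W) : HomExact P W := by
  have nat (i j : ℕ) (hij : i ≤ j) (hj : j ≤ m) :
      e.inv.app ⟨i, by omega⟩ ≫ V.map' i j = W.map' i j ≫ e.inv.app ⟨j, by omega⟩ :=
    (e.inv.naturality _).symm
  have cancel {U : C} {i : Fin (m + 1)} {u u' : U ⟶ W.obj i}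
      (huu : u ≫ e.inv.app i = u' ≫ e.inv.app i) : u = u' := (cancel_mono _).1 huu
  refine ⟨?_, ?_, ?_, ?_⟩
  · intro U hU hm u
    exact cancel ((h.zero U hU hm _).trans zero_comp.symm)
  · intro U hU hm u u' huu
    refine cancel (h.injective U hU hm ?_)
    dsimp only at huu ⊢
    rw [Category.assoc, Category.assoc, nat 0 1 (by omega) hm, reassoc_of% huu]
  · intro U hU i hi u
    have h1 := h.exact U hU i hi (u ≫ e.inv.app ⟨i + 1, by omega⟩)
    dsimp only at h1 ⊢
    rw [Category.assoc, nat (i + 1) (i + 2) (by omega) hi, ← Category.assoc] at h1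
    constructor
    · intro hu
      obtain ⟨w, hw⟩ := h1.1 (by rw [hu, zero_comp])
      refine ⟨w ≫ e.hom.app _, cancel ?_⟩
      dsimp only at hw ⊢
      rw [Category.assoc, ← nat i (i + 1) (by omega) (by omega), ← hw]
      simp
    · rintro ⟨w, rfl⟩
      refine cancel ((h1.2 ⟨w ≫ e.inv.app _, ?_⟩).trans zero_comp.symm)
      dsimp only
      rw [Category.assoc, nat i (i + 1) (by omega) (by omega), Category.assoc]
  · intro U hU hm u
    obtain ⟨w, hw⟩ := h.surjective U hU hm (u ≫ e.inv.app _)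
    refine ⟨w ≫ e.hom.app _, cancel ?_⟩
    dsimp only at hw ⊢
    rw [Category.assoc, Category.assoc, ← nat (m - 1) m (by omega) le_rfl, ← hw]
    simp

/-! ### Torsion subobjects -/

namespace IsTorsionSubobject

variable {n : ℕ} {P : ObjectProperty C} {X M : C} {f : X ⟶ M}

lemma mono (h : IsTorsionSubobject n P f) : Mono f := by
  obtain ⟨-, S, hf, hS, -⟩ := h
  exact hf.mono_iff.1 hS.isNKernel.mono

lemma precomp_iso [P.IsClosedUnderIsomorphisms] (h : IsTorsionSubobject n P f) {X' : C}
    (e : X' ≅ X) : IsTorsionSubobject n P (e.hom ≫ f) := by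
  obtain ⟨hX, S, hf, hS, hV⟩ := h
  exact ⟨P.prop_of_iso e.symm hX, S, hf.precomp_iso e, hS, hV⟩

lemma exists_lift (hn : 1 ≤ n) (h : IsTorsionSubobject n P f) {U : C} (hU : P U) (u : U ⟶ M) :
    ∃ w : U ⟶ X, w ≫ f = u := by
  obtain ⟨m, rfl⟩ : ∃ m, n = m + 1 := ⟨n - 1, by omega⟩
  obtain ⟨-, S, ⟨e₀, e₁, w⟩, hS, hV⟩ := h
  obtain ⟨v, hv⟩ := ((hS.homExact_tail_iff P).1 hV U hU).1 (u ≫ e₁.inv)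
  refine ⟨v ≫ e₀.hom, ?_⟩
  dsimp only at hv
  rw [Category.assoc, ← w, reassoc_of% hv, Iso.inv_hom_id, Category.comp_id]

/-- The exactness condition for a torsion subobject `f` holds for every `n`-exact sequence starting
with `f`. -/
lemma homExact_tail (hn : 1 ≤ n) (h : IsTorsionSubobject n P f)
    {S : ComposableArrows C (n + 1)} (hf : StartsWith S f) (hS : IsNExact S) :
    HomExact P (tail S) := by
  obtain ⟨m, rfl⟩ : ∃ m, n = m + 1 := ⟨n - 1, by omega⟩
  refine (hS.homExact_tail_iff P).2 fun U hU => ⟨fun u => ?_, ?_⟩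
  · obtain ⟨e₀, e₁, w⟩ := hf
    obtain ⟨v, hv⟩ := h.exists_lift hn hU (u ≫ e₁.hom)
    refine ⟨v ≫ e₀.inv, ?_⟩
    rw [← cancel_mono e₁.hom, ← hv]
    dsimp only
    rw [Category.assoc, Category.assoc, w, Iso.inv_hom_id_assoc]
  · obtain ⟨-, S', hf', hS', hV⟩ := h
    exact hS.isNCokernel.surjective_last_of_startsWith hS'.isNCokernel hf hf'
      ((hS'.homExact_tail_iff P).1 hV U hU).2

end IsTorsionSubobject

end Sequences
end HigherHN

namespace HigherHN

variable {C : Type u} [Category.{v} C] [Preadditive C]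

/-! ### Closure of torsion classes under `n`-extensions -/

lemma IsTorsionSubobject.mk_le_mk {n : ℕ} (hn : 1 ≤ n) {P : ObjectProperty C} {M X Y : C}
    {f : X ⟶ M} {g : Y ⟶ M} [Mono f] [Mono g] (hg : IsTorsionSubobject n P g) (hX : P X) :
    Subobject.mk f ≤ Subobject.mk g := by
  obtain ⟨w, hw⟩ := hg.exists_lift hn hX f
  exact Subobject.mk_le_mk_of_comm w hw

/-- Let `A ⟶ N ⟶ V¹ ⟶ ⋯ ⟶ Vⁿ` and `Y ⟶ M ⟶ V¹ ⟶ ⋯ ⟶ Vⁿ` be two `n`-cokernel sequences with the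
same right-hand part. If `N` and `Y` lie in the `n`-torsion class `P`, then so does `M`. This
replaces the closure of ordinary torsion classes under extensions and quotients. -/
lemma IsNTorsionClass.prop_of_tail_iso {n : ℕ} (hn : 1 ≤ n) {P : ObjectProperty C}
    (hP : IsNTorsionClass n P) {S T : ComposableArrows C (n + 1)} (hS : IsNCokernel S)
    (hT : IsNCokernel T) (e : tail S ≅ tail T) (h₁ : P (S.obj' 1)) (h₀ : P (T.obj' 0)) :
    P (T.obj' 1) := by
  obtain ⟨m, rfl⟩ : ∃ m, n = m + 1 := ⟨n - 1, by omega⟩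
  have := hP.closedUnderIso
  obtain ⟨X, f, hf⟩ := hP.exists_torsionSubobject (T.obj' 1)
  have := hf.mono
  obtain ⟨-, Z, ⟨e₀, e₁, w⟩, hZ, hV⟩ := id hf
  have hZd : Z.map' 0 1 ≫ Z.map' 1 2 = 0 := hZ.isNCokernel.comp_eq_zero 0 (by omega)
  -- With `X ⟶ M ⟶ Z¹ ⟶ ⋯ ⟶ Zⁿ` the sequence of the torsion subobject of `M`, it suffices that
  -- `M ⟶ Z¹` vanishes, since then the identity of `M` factors through `X`.
  suffices h : e₁.inv ≫ Z.map' 1 2 = 0 by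
    obtain ⟨v, hv⟩ := hZ.isNKernel.exists_lift 0 (by omega) _ h
    have hvf : (v ≫ e₀.hom) ≫ f = 𝟙 _ := by
      rw [Category.assoc, ← w, reassoc_of% hv, Iso.inv_hom_id]
    have hfv : f ≫ (v ≫ e₀.hom) = 𝟙 _ := by
      rw [← cancel_mono f, Category.assoc, hvf, Category.comp_id, Category.id_comp]
    exact P.prop_of_iso ⟨f, v ≫ e₀.hom, hfv, hvf⟩ hf.1
  -- As `Y` is in `P`, the morphism `M ⟶ Z¹` kills it, hence factors through some `g : V¹ ⟶ Z¹`.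
  have h₀' : T.map' 0 1 ≫ e₁.inv ≫ Z.map' 1 2 = 0 := by
    obtain ⟨v, hv⟩ := hf.exists_lift hn h₀ (T.map' 0 1)
    rw [← hv, Category.assoc, ← reassoc_of% (inv_comp_eq_comp_inv w), hZd, comp_zero, comp_zero]
  obtain ⟨g, hg⟩ := hT.exists_desc 0 (by omega) _ h₀'
  let e₂ : S.obj' 2 ≅ T.obj' 2 := e.app 0
  -- As `g` extends to a morphism of sequences from `V` to `Z` and `Hom(N, Z¹) ⟶ Hom(N, Z²)` is
  -- injective (for `n = 1`, `Hom(N, Z¹)` vanishes), the composite `N ⟶ V¹ ⟶ Z¹` is zero.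
  have hN : S.map' 1 2 ≫ e₂.hom ≫ g = 0 := by
    rcases Nat.eq_zero_or_pos m with hm | hm
    · exact hV.zero _ h₁ hm _
    · refine hV.injective _ h₁ hm (Eq.trans ?_ zero_comp.symm)
      change (S.map' 1 2 ≫ e₂.hom ≫ g) ≫ Z.map' 2 3 = 0
      have hTd' : T.map' 1 2 ≫ T.map' 2 3 = 0 := hT.comp_eq_zero 1 (by omega)
      have hSd' : S.map' 1 2 ≫ S.map' 2 3 = 0 := hS.comp_eq_zero 1 (by omega)
      have hZd' : Z.map' 1 2 ≫ Z.map' 2 3 = 0 := hZ.isNCokernel.comp_eq_zero 1 (by omega)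
      obtain ⟨g', hg'⟩ := hT.exists_desc 1 (by omega) (g ≫ Z.map' 2 3)
        (by rw [reassoc_of% hg, hZd', comp_zero])
      let e₃ : S.obj' 3 ≅ T.obj' 3 := e.app ⟨1, by omega⟩
      have he : S.map' 2 3 ≫ e₃.hom = e₂.hom ≫ T.map' 2 3 :=
        e.hom.naturality (homOfLE (by simp) : (0 : Fin (m + 1)) ⟶ ⟨1, by omega⟩)
      rw [Category.assoc, Category.assoc, ← hg', ← reassoc_of% he, reassoc_of% hSd', zero_comp]
  -- Hence `g` factors through `V¹ ⟶ V²` (for `n = 1`, it is zero), so that its composite with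
  -- `M ⟶ V¹` vanishes.
  rw [← hg]
  rcases Nat.eq_zero_or_pos m with rfl | hm
  · have : e₂.hom ≫ g = 0 := hS.eq_zero_of_last _ hN
    rw [(cancel_epi e₂.hom).1 (this.trans comp_zero.symm)]
    exact comp_zero
  · have hTd' : T.map' 1 2 ≫ T.map' 2 3 = 0 := hT.comp_eq_zero 1 (by omega)
    obtain ⟨g'', hg''⟩ := hS.exists_desc 1 (by omega) _ hN
    let e₃ : S.obj' 3 ≅ T.obj' 3 := e.app ⟨1, by omega⟩
    have he : S.map' 2 3 ≫ e₃.hom = e₂.hom ≫ T.map' 2 3 :=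
      e.hom.naturality (homOfLE (by simp) : (0 : Fin (m + 1)) ⟶ ⟨1, by omega⟩)
    have : g = T.map' 2 3 ≫ e₃.inv ≫ g'' := by
      rw [← cancel_epi e₂.hom, ← reassoc_of% he, Iso.hom_inv_id_assoc, hg'']
    rw [this]
    exact (reassoc_of% hTd') _ |>.trans zero_comp

/-! ### Chains of torsion classes: phases and torsion subobjects -/

namespace NTorsionChain

variable {n : ℕ} (δ : NTorsionChain C n)

lemma above_of_lt {r t : unitInterval} (h : t < r) {X : C} (hX : δ.U r X) : δ.above t X :=
  Or.inr ⟨r, h, hX⟩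

lemma U_of_isZero (r : unitInterval) {X : C} (hX : IsZero X) : δ.U r X :=
  δ.antitone r 1 unitInterval.le_one' X ((δ.one X).2 hX)

lemma U_of_above {r t : unitInterval} (h : r ≤ t) {X : C} (hX : δ.above t X) : δ.U r X := by
  rcases hX with hX | ⟨s, hs, hX⟩
  · exact δ.U_of_isZero r hX
  · exact δ.antitone r s (h.trans hs.le) X hX

lemma above_of_below {s t : unitInterval} (h : s < t) {X : C} (hX : δ.below t X) :
    δ.above s X := by
  obtain ⟨r, hsr, hrt⟩ := exists_between h
  exact δ.above_of_lt hsr (hX r hrt)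

instance (t : unitInterval) : (δ.above t).IsClosedUnderIsomorphisms where
  of_iso e h := by
    rcases h with h | ⟨r, hr, h⟩
    · exact Or.inl (h.of_iso e.symm)
    · have := (δ.isNTorsionClass r).closedUnderIso
      exact δ.above_of_lt hr ((δ.U r).prop_of_iso e h)

/-- A nonzero object has a phase: the supremum of all `r` such that the object lies in `U_r`. -/
lemma exists_S {X : C} (hX : ¬ IsZero X) : ∃ t, δ.S t X := by
  refine ⟨sSup {r | δ.U r X}, fun s hs => ?_, ?_⟩
  · obtain ⟨r, hr, hsr⟩ := lt_sSup_iff.1 hs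
    exact δ.antitone s r hsr.le X hr
  · rintro (h | ⟨r, hr, h⟩)
    · exact hX h
    · exact (le_sSup (show r ∈ {r | δ.U r X} from h)).not_gt hr

lemma S_unique {s t : unitInterval} {X : C} (hs : δ.S s X) (ht : δ.S t X) : s = t := by
  by_contra h
  rcases lt_or_gt_of_ne h with h | h
  · exact hs.2 (δ.above_of_below h ht.1)
  · exact ht.2 (δ.above_of_below h hs.1)

lemma lt_of_above_of_S {s t : unitInterval} {X : C} (h : δ.above t X) (hs : δ.S s X) : t < s := by
  by_contra! hst
  rcases h with h | ⟨r, hr, h⟩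
  · exact hs.2 (Or.inl h)
  · exact hs.2 (δ.above_of_lt (hst.trans_lt hr) h)

/-- Every object has a torsion subobject with respect to the union of the `U_r` with `r > t`. The
torsion subobjects with respect to the single classes `U_r` grow as `r` decreases to `t`, so by the
ascending chain condition they become stationary, and the stationary value is the torsion
subobject with respect to the union. -/
lemma exists_torsionSubobject_above (hn : 1 ≤ n) (t : unitInterval) (M : C)
    [IsNoetherianObject M] :
    ∃ (X : C) (f : X ⟶ M), IsTorsionSubobject n (δ.above t) f := by
  rcases (unitInterval.le_one' : t ≤ 1).eq_or_lt with rfl | ht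
  · obtain ⟨X, f, hX, S, hf, hS, hV⟩ := (δ.isNTorsionClass 1).exists_torsionSubobject M
    have : δ.above 1 = δ.U 1 := by
      ext Y
      exact ⟨fun h => δ.U_of_above le_rfl h, fun h => Or.inl ((δ.one Y).1 h)⟩
    exact ⟨X, f, by rw [this]; exact ⟨hX, S, hf, hS, hV⟩⟩
  choose X f hf using fun r => (δ.isNTorsionClass r).exists_torsionSubobject M
  have hmono (r) : Mono (f r) := (hf r).mono
  obtain ⟨-, ⟨r₀, hr₀, rfl⟩, hmax⟩ := WellFounded.has_min
    (wellFounded_gt : WellFounded ((· > ·) : Subobject M → Subobject M → Prop))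
    ((fun r => Subobject.mk (f r)) '' Set.Ioi t) ⟨_, 1, ht, rfl⟩
  obtain ⟨-, S, hS₀, hS, -⟩ := id (hf r₀)
  -- Below `r₀` the torsion subobjects agree, so the `n`-exact sequence for `r₀` also serves there.
  have key (r : unitInterval) (hr : t < r) (hr' : r ≤ r₀) : HomExact (δ.U r) (tail S) := by
    have hle : Subobject.mk (f r₀) ≤ Subobject.mk (f r) :=
      (hf r).mk_le_mk hn (δ.antitone r r₀ hr' _ (hf r₀).1)
    have heq : Subobject.mk (f r₀) = Subobject.mk (f r) :=
      hle.eq_or_lt.resolve_right (hmax _ ⟨r, hr, rfl⟩)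
    have := (δ.isNTorsionClass r).closedUnderIso
    have h := (hf r).precomp_iso (Subobject.isoOfMkEqMk _ _ heq)
    rw [Subobject.isoOfMkEqMk_hom, Subobject.ofMkLEMk_comp] at h
    exact h.homExact_tail hn hS₀ hS
  have key' (U : C) (hU : δ.above t U) : ∃ r, δ.U r U ∧ HomExact (δ.U r) (tail S) := by
    rcases hU with hU | ⟨r, hr, hU⟩
    · exact ⟨r₀, δ.U_of_isZero _ hU, key r₀ hr₀ le_rfl⟩
    · exact ⟨min r r₀, δ.antitone _ r (min_le_left _ _) U hU,
        key _ (lt_min hr hr₀) (min_le_right _ _)⟩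
  refine ⟨X r₀, f r₀, δ.above_of_lt hr₀ (hf r₀).1, S, hS₀, hS, ?_, ?_, ?_, ?_⟩ <;>
    intro U hU <;> obtain ⟨r, hrU, h⟩ := key' U hU
  exacts [h.zero U hrU, h.injective U hrU, h.exact U hrU, h.surjective U hrU]

/-- If the `n`-cokernel of a monomorphism `f : Y ⟶ M` which is not an isomorphism lies in the slice
of phase `t` and `Y` lies in the union of the classes with index `> t`, then `M` has phase `t` and
`f` is its torsion subobject with respect to this union. -/
lemma S_and_isTorsionSubobject_of_slice [HasZeroObject C] [HasFiniteBiproducts C] (hn : 1 ≤ n)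
    (hC : IsNAbelian C n) {t : unitInterval} {Y M : C} {f : Y ⟶ M} [Mono f] (hf : ¬ IsIso f)
    (hY : δ.above t Y) {T : ComposableArrows C (n + 1)} (hTf : StartsWith T f)
    (hT : IsNCokernel T) (hV : δ.slice t (tail T)) :
    δ.S t M ∧ IsTorsionSubobject n (δ.above t) f := by
  have hTex : IsNExact T := hC.isNExact_of_mono T (hTf.mono_iff.2 inferInstance) hT
  obtain ⟨X, N, α, hN, hα, S, hSα, hS, ⟨e⟩⟩ := hV
  have := hα.mono
  have hSex : IsNExact S := hC.isNExact_of_mono S (hSα.mono_iff.2 inferInstance) hS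
  have htors : IsTorsionSubobject n (δ.above t) f :=
    ⟨hY, T, hTf, hTex, (hα.homExact_tail hn hSα hSex).of_iso e⟩
  refine ⟨⟨fun s hs => ?_, fun hM => hf ?_⟩, htors⟩
  · have hU := δ.isNTorsionClass s
    have := hU.closedUnderIso
    obtain ⟨e₀, e₁, -⟩ := hTf
    obtain ⟨-, e₁', -⟩ := hSα
    exact (δ.U s).prop_of_iso e₁ (hU.prop_of_tail_iso hn hS hT e
      ((δ.U s).prop_of_iso e₁'.symm (hN.1 s hs))
      ((δ.U s).prop_of_iso e₀.symm (δ.U_of_above hs.le hY)))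
  · obtain ⟨v, hv⟩ := htors.exists_lift hn hM (𝟙 M)
    have : IsSplitEpi f := ⟨⟨⟨v, hv⟩⟩⟩
    exact isIso_of_mono_of_isSplitEpi f

end NTorsionChain

end HigherHN

namespace HigherHN

/-! ### Chains of iterated steps in a partial order -/

section Order

variable {α ι : Type*}

/-- A finite sequence from `⊥` to `a` in which the term of index `k`, with the label `phase k`, is
obtained from the following one by the relation `R`. -/
def IsStepChain [Bot α] (R : α → ι → α → Prop) (a : α) (r : ℕ) (sub : Fin (r + 1) → α)
    (phase : Fin r → ι) : Prop :=
  sub 0 = ⊥ ∧ sub (Fin.last r) = a ∧ ∀ k : Fin r, R (sub k.succ) (phase k) (sub k.castSucc)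

variable [PartialOrder α] [OrderBot α] {R : α → ι → α → Prop}

lemma IsStepChain.init {a : α} {r : ℕ} {sub : Fin (r + 2) → α} {phase : Fin (r + 1) → ι}
    (h : IsStepChain R a (r + 1) sub phase) :
    IsStepChain R (sub (Fin.last r).castSucc) r (Fin.init sub) (Fin.init phase) :=
  ⟨h.1, rfl, fun k => h.2.2 k.castSucc⟩

lemma IsStepChain.last {a : α} {r : ℕ} {sub : Fin (r + 2) → α} {phase : Fin (r + 1) → ι}
    (h : IsStepChain R a (r + 1) sub phase) :
    R a (phase (Fin.last r)) (sub (Fin.last r).castSucc) := by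
  simpa only [Fin.succ_last, h.2.1] using h.2.2 (Fin.last r)

lemma exists_isStepChain [WellFoundedLT α] (hlt : ∀ a t b, R a t b → b < a)
    (hex : ∀ a, a ≠ ⊥ → ∃ t b, R a t b) (a : α) : ∃ r sub phase, IsStepChain R a r sub phase := by
  induction a using WellFoundedLT.induction with
  | ind a ih =>
    by_cases ha : a = ⊥
    · exact ⟨0, fun _ => a, Fin.elim0, ha, rfl, fun k => k.elim0⟩
    · obtain ⟨t, b, hR⟩ := hex a ha
      obtain ⟨r, sub, phase, h₀, h₁, h₂⟩ := ih b (hlt a t b hR)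
      refine ⟨r + 1, Fin.snoc sub a, Fin.snoc phase t, ?_, Fin.snoc_last _ _, ?_⟩
      · rw [← Fin.castSucc_zero, Fin.snoc_castSucc, h₀]
      · intro k
        induction k using Fin.lastCases with
        | last => simpa only [Fin.succ_last, Fin.snoc_last, Fin.snoc_castSucc, h₁] using hR
        | cast k => simpa only [Fin.succ_castSucc, Fin.snoc_castSucc] using h₂ k

lemma IsStepChain.unique (hlt : ∀ a t b, R a t b → b < a)
    (huniq : ∀ a t b t' b', R a t b → R a t' b' → t = t' ∧ b = b') {a : α} {r r' : ℕ}
    {sub : Fin (r + 1) → α} {phase : Fin r → ι} {sub' : Fin (r' + 1) → α} {phase' : Fin r' → ι}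
    (h : IsStepChain R a r sub phase) (h' : IsStepChain R a r' sub' phase') :
    r = r' ∧ HEq sub sub' ∧ HEq phase phase' := by
  induction r generalizing a r' with
  | zero =>
    obtain rfl : ⊥ = a := h.1.symm.trans h.2.1
    cases r' with
    | zero =>
      refine ⟨rfl, heq_of_eq (funext fun i => ?_), heq_of_eq (funext fun i => i.elim0)⟩
      obtain rfl : i = 0 := Fin.fin_one_eq_zero i
      rw [h.1, h'.1]
    | succ r' => exact absurd (hlt _ _ _ h'.last) not_lt_bot
  | succ r ih =>
    cases r' with
    | zero =>
      obtain rfl : ⊥ = a := h'.1.symm.trans h'.2.1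
      exact absurd (hlt _ _ _ h.last) not_lt_bot
    | succ r' =>
      obtain ⟨ht, hb⟩ := huniq _ _ _ _ _ h.last h'.last
      have hi := h'.init
      rw [← hb] at hi
      obtain ⟨rfl, hs, hp⟩ := ih h.init hi
      refine ⟨rfl, heq_of_eq ?_, heq_of_eq ?_⟩
      · rw [← Fin.snoc_init_self sub, ← Fin.snoc_init_self sub', eq_of_heq hs, h.2.1, h'.2.1]
      · rw [← Fin.snoc_init_self phase, ← Fin.snoc_init_self phase', eq_of_heq hp, ht]

end Order

/-! ### Harder–Narasimhan filtrations -/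

variable {C : Type u} [Category.{v} C] [Preadditive C] {n : ℕ}

namespace NTorsionChain

variable (δ : NTorsionChain C n) {M : C}

/-- `δ.IsStep A t B` says that the subobject `A` of `M` has phase `t` and that `B` is its torsion
subobject with respect to the union of the classes with index `> t`. -/
def IsStep (A : Subobject M) (t : unitInterval) (B : Subobject M) : Prop :=
  ∃ h : B ≤ A, δ.S t (A : C) ∧ IsTorsionSubobject n (δ.above t) (Subobject.ofLE B A h)

variable {δ}

lemma IsStep.lt {A B : Subobject M} {t : unitInterval} (h : δ.IsStep A t B) : B < A := by
  obtain ⟨hle, hA, hB⟩ := h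
  refine lt_of_le_of_ne hle ?_
  rintro rfl
  exact hA.2 hB.1

lemma IsStep.unique (hn : 1 ≤ n) {A B B' : Subobject M} {t t' : unitInterval}
    (h : δ.IsStep A t B) (h' : δ.IsStep A t' B') : t = t' ∧ B = B' := by
  obtain ⟨hle, hA, hB⟩ := h
  obtain ⟨hle', hA', hB'⟩ := h'
  obtain rfl := δ.S_unique hA hA'
  refine ⟨rfl, le_antisymm ?_ ?_⟩
  · obtain ⟨w, hw⟩ := hB'.exists_lift hn hB.1 (Subobject.ofLE B A hle)
    exact Subobject.le_of_comm w (by rw [← Subobject.ofLE_arrow hle', reassoc_of% hw]; simp)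
  · obtain ⟨w, hw⟩ := hB.exists_lift hn hB'.1 (Subobject.ofLE B' A hle')
    exact Subobject.le_of_comm w (by rw [← Subobject.ofLE_arrow hle, reassoc_of% hw]; simp)

lemma IsStep.phase_lt {A B D : Subobject M} {s t : unitInterval} (h : δ.IsStep A t B)
    (h' : δ.IsStep B s D) : t < s :=
  δ.lt_of_above_of_S h.2.2.1 h'.2.1

variable [HasZeroObject C] (δ)

lemma exists_isStep (hn : 1 ≤ n) {A : Subobject M} (hA : A ≠ ⊥) [IsNoetherianObject (A : C)] :
    ∃ t B, δ.IsStep A t B := by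
  have hA' : ¬ IsZero (A : C) := by
    intro h
    refine hA ?_
    rw [← Subobject.mk_arrow A, Subobject.mk_eq_bot_iff_zero]
    exact h.eq_of_src _ _
  obtain ⟨t, ht⟩ := δ.exists_S hA'
  obtain ⟨X, f, hf⟩ := δ.exists_torsionSubobject_above hn t (A : C)
  have := hf.mono
  have hle : Subobject.mk (f ≫ A.arrow) ≤ A := Subobject.mk_le_of_comm f rfl
  refine ⟨t, Subobject.mk (f ≫ A.arrow), hle, ht, ?_⟩
  convert hf.precomp_iso (Subobject.underlyingIso (f ≫ A.arrow)) using 1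
  rw [← cancel_mono A.arrow]
  simp

end NTorsionChain

namespace HNFiltration

variable [HasZeroObject C] {δ : NTorsionChain C n} {M : C}

lemma isStep_of_above [HasFiniteBiproducts C] (hn : 1 ≤ n) (hC : IsNAbelian C n)
    (F : HNFiltration δ M) (k : Fin F.length)
    (hk : δ.above (F.phase k) (F.sub k.castSucc : C)) :
    δ.IsStep (F.sub k.succ) (F.phase k) (F.sub k.castSucc) := by
  obtain ⟨T, hTf, hT, hV⟩ := F.slice k
  have hlt := F.strictMono k.castSucc_lt_succ
  refine ⟨hlt.le, δ.S_and_isTorsionSubobject_of_slice hn hC (fun h => hlt.not_ge ?_) hk hTf hT hV⟩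
  exact Subobject.le_of_comm (inv (Subobject.ofLE _ _ hlt.le)) (by simp)

/-- The terms of a Harder–Narasimhan filtration are determined from the top downwards: `M_{k-1}` is
the torsion subobject of `M_k` with respect to the classes of index larger than the phase of
`M_k`. -/
lemma isStepChain [HasFiniteBiproducts C] (hn : 1 ≤ n) (hC : IsNAbelian C n)
    (F : HNFiltration δ M) : IsStepChain δ.IsStep ⊤ F.length F.sub F.phase := by
  refine ⟨F.sub_zero, F.sub_last, ?_⟩
  suffices h : ∀ (i : ℕ) (hi : i < F.length),
      δ.IsStep (F.sub (Fin.succ ⟨i, hi⟩)) (F.phase ⟨i, hi⟩) (F.sub (Fin.castSucc ⟨i, hi⟩)) from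
    fun k => h k k.2
  intro i hi
  induction i with
  | zero =>
    refine F.isStep_of_above hn hC _ (Or.inl ?_)
    have : F.sub (Fin.castSucc ⟨0, hi⟩) = ⊥ := F.sub_zero
    rw [this]
    exact (isZero_zero C).of_iso Subobject.botCoeIsoZero
  | succ i ih =>
    exact F.isStep_of_above hn hC _ (δ.above_of_below (F.strictAnti (Fin.mk_lt_mk.2 i.lt_succ_self))
      (ih (by omega)).2.1.1)

/-- The Harder–Narasimhan filtration given by iterated steps. -/
def ofIsStepChain {r : ℕ} {sub : Fin (r + 1) → Subobject M} {phase : Fin r → unitInterval}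
    (h : IsStepChain δ.IsStep ⊤ r sub phase) : HNFiltration δ M where
  length := r
  sub := sub
  phase := phase
  sub_zero := h.1
  sub_last := h.2.1
  strictMono := Fin.strictMono_iff_lt_succ.2 fun k => (h.2.2 k).lt
  strictAnti := by
    cases r with
    | zero => exact fun k => k.elim0
    | succ r => exact Fin.strictAnti_iff_succ_lt.2 fun k =>
        (h.2.2 k.succ).phase_lt (h.2.2 k.castSucc)
  slice k := by
    obtain ⟨_, hS, hf⟩ := h.2.2 k
    obtain ⟨-, T, hTf, hT, -⟩ := id hf
    exact ⟨T, hTf, hT.isNCokernel, _, _, _, hS, hf, T, hTf, hT.isNCokernel, ⟨Iso.refl _⟩⟩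

end HNFiltration

end HigherHN

theorem mainTheorem2 {C : Type u} [Category.{v} C] [Preadditive C] [HasZeroObject C]
    [HasFiniteBiproducts C] (n : ℕ) (hn : 1 ≤ n) (hC : HigherHN.IsNAbelian C n)
    (hArt : ∀ X : C, IsArtinianObject X) (hNoeth : ∀ X : C, IsNoetherianObject X)
    (δ : HigherHN.NTorsionChain C n) (M : C) :
    ∃ F : HigherHN.HNFiltration δ M,
      (∀ F' : HigherHN.HNFiltration δ M, F' = F) ∧
      ∀ k : Fin F.length,
        δ.S (F.phase k) (F.sub k.succ : C) ∧
        HigherHN.IsTorsionSubobject n (δ.above (F.phase k))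
          (Subobject.ofLE (F.sub k.castSucc) (F.sub k.succ)
            (F.strictMono.monotone (Fin.castSucc_le_succ k))) := by

  have := hArt M
  obtain ⟨r, sub, phase, h⟩ := HigherHN.exists_isStepChain (R := δ.IsStep (M := M))
    (fun _ _ _ => HigherHN.NTorsionChain.IsStep.lt)
    (fun A hA => have := hNoeth (A : C); δ.exists_isStep hn hA) ⊤
  refine ⟨.ofIsStepChain h, fun F' => ?_, fun k => (h.2.2 k).2⟩
  have h' := F'.isStepChain hn hC
  cases F' with
  | mk r' sub' phase' =>
    obtain ⟨rfl, hs, hp⟩ := h'.unique (fun _ _ _ => HigherHN.NTorsionChain.IsStep.lt)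
      (fun _ _ _ _ _ => HigherHN.NTorsionChain.IsStep.unique hn) h
    obtain rfl := eq_of_heq hs
    obtain rfl := eq_of_heq hp
    rfl
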